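/- Let $K$ be an algebraically closed field. For $m \ge 0$ let $T_m$ be the space of upper triangular $m\times m$ matrices over $K$, and let $$CT_m=\{(X,Y)\in T_m\times T_m : XY=YX\},$$ a Zariski closed subset of the affine space $T_m\times T_m\cong K^{m(m+1)}$. A closed subset $V$ of an affine space $K^N$ is called a complete intersection if it is the zero locus of $N-\dim V$ polynomials. Suppose that $n\ge 1$ and that $CT_{n-1}$ is a complete intersection, and let $(X,Y)\in CT_n$ be such that $X$ or $Y$ has at least two distinct eigenvalues. Then $(X,Y)$ belongs to no irreducible component of $CT_n$ of dimension greater than $\dfrac{n(n+3)}{2}$. -/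

import Mathlib

noncomputable section

/-! ## Affine varieties over a field, as sets of points of affine space `σ → K` -/

/-- The Zariski topology on affine space: the closed sets are the zero loci of sets of
polynomials. -/
@[reducible] def zariskiTopology (K : Type*) [Field K] (σ : Type*) : TopologicalSpace (σ → K) :=
  TopologicalSpace.ofClosed
    {V | ∃ S : Set (MvPolynomial σ K), V = {x | ∀ f ∈ S, MvPolynomial.eval x f = 0}}
    ⟨{1}, by ext x; simp⟩
    (by
      intro A hA
      refine ⟨{f | ∃ V ∈ A, ∀ x ∈ V, MvPolynomial.eval x f = 0}, ?_⟩
      ext x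
      constructor
      · rintro hx f ⟨V, hV, hf⟩
        exact hf x (hx V hV)
      · intro hx V hV
        obtain ⟨S, rfl⟩ := hA hV
        intro f hf
        exact hx f ⟨_, hV, fun y hy => hy f hf⟩)
    (by
      rintro _ ⟨S, rfl⟩ _ ⟨T, rfl⟩
      refine ⟨{h | ∃ f ∈ S, ∃ g ∈ T, h = f * g}, ?_⟩
      ext x
      constructor
      · rintro (hx | hx) _ ⟨f, hf, g, hg, rfl⟩
        · simp [hx f hf]
        · simp [hx g hg]
      · intro hx
        by_contra hcon
        simp only [Set.mem_union, Set.mem_ofPred_eq, not_or, not_forall] at hcon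
        obtain ⟨⟨f, hf, hfx⟩, ⟨g, hg, hgx⟩⟩ := hcon
        have h0 := hx (f * g) ⟨f, hf, g, hg, rfl⟩
        rw [map_mul] at h0
        exact (mul_ne_zero hfx hgx) h0)

/-- `Z` is an irreducible component of `V`: a maximal element among the subsets of `V` which are
irreducible for the Zariski topology. -/
def IsIrredComponent {K : Type*} [Field K] {σ : Type*} (V Z : Set (σ → K)) : Prop :=
  Maximal (fun W : Set (σ → K) => W ⊆ V ∧ @IsIrreducible _ (zariskiTopology K σ) W) Z

/-- The dimension of a variety `V` in affine space: the Krull dimension of its coordinate ring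
`K[σ] / I(V)`. -/
def varietyDim {K : Type*} [Field K] {σ : Type*} (V : Set (σ → K)) : WithBot ℕ∞ :=
  ringKrullDim (MvPolynomial σ K ⧸ MvPolynomial.vanishingIdeal K V)

/-- `V` is a complete intersection in the affine space `K^σ`: it is the zero locus of `c`
polynomials, where `c = |σ| - dim V` is its codimension. -/
def IsCompleteIntersection {K : Type*} [Field K] {σ : Type*} [Fintype σ]
    (V : Set (σ → K)) : Prop :=
  ∃ (c : ℕ) (f : Fin c → MvPolynomial σ K),
    varietyDim V + (c : WithBot ℕ∞) = (Fintype.card σ : WithBot ℕ∞) ∧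
      V = {x | ∀ i, MvPolynomial.eval x (f i) = 0}

/-! ## Pairs of commuting upper triangular matrices -/

/-- The positions `(i, j)`, `i ≤ j`, of the entries of an upper triangular `n × n` matrix. -/
abbrev UpperIdx (n : ℕ) : Type := {q : Fin n × Fin n // q.1 ≤ q.2}

/-- The upper triangular matrix with prescribed entries on and above the diagonal. This
identifies the affine space `UpperIdx n → K` with the space `T_n`. -/
def upperMatrix {K : Type*} [Field K] {n : ℕ} (x : UpperIdx n → K) : Matrix (Fin n) (Fin n) K :=
  Matrix.of fun i j => if h : i ≤ j then x ⟨(i, j), h⟩ else 0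

theorem upperMatrix_injective {K : Type*} [Field K] {n : ℕ} :
    Function.Injective (upperMatrix : (UpperIdx n → K) → Matrix (Fin n) (Fin n) K) := by
  intro x y hxy
  funext ⟨⟨i, j⟩, h⟩
  have h' : i ≤ j := h
  have := congrFun (congrFun hxy i) j
  simpa [upperMatrix, h'] using this

theorem range_upperMatrix {K : Type*} [Field K] {n : ℕ} :
    Set.range (upperMatrix : (UpperIdx n → K) → Matrix (Fin n) (Fin n) K) =
      {A | A.BlockTriangular id} := by
  ext A
  constructor
  · rintro ⟨x, rfl⟩ i j hij
    have : ¬ i ≤ j := not_le.mpr hij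
    simp [upperMatrix, this]
  · intro hA
    refine ⟨fun q => A q.1.1 q.1.2, ?_⟩
    ext i j
    by_cases h : i ≤ j
    · simp [upperMatrix, h]
    · simpa [upperMatrix, h] using (hA (not_le.mp h)).symm

/-- The coordinates of the affine space `T_n × T_n`. -/
abbrev PairIdx (n : ℕ) : Type := UpperIdx n ⊕ UpperIdx n

/-- The first matrix `X` of a point `(X, Y)` of `T_n × T_n`. -/
def matX {K : Type*} [Field K] {n : ℕ} (p : PairIdx n → K) : Matrix (Fin n) (Fin n) K :=
  upperMatrix fun q => p (Sum.inl q)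

/-- The second matrix `Y` of a point `(X, Y)` of `T_n × T_n`. -/
def matY {K : Type*} [Field K] {n : ℕ} (p : PairIdx n → K) : Matrix (Fin n) (Fin n) K :=
  upperMatrix fun q => p (Sum.inr q)

/-- The variety `CT_n` of pairs of commuting upper triangular `n × n` matrices, in the affine
space `T_n × T_n`. -/
def CT (K : Type*) [Field K] (n : ℕ) : Set (PairIdx n → K) :=
  {p | matX p * matY p = matY p * matX p}

/-- The matrix `A` has at least two (distinct) eigenvalues in `K`. -/
def HasTwoEigenvalues {K : Type*} [Field K] {n : ℕ} (A : Matrix (Fin n) (Fin n) K) : Prop :=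
  ∃ a b : K, a ≠ b ∧ Module.End.HasEigenvalue (Matrix.toLin' A) a ∧
    Module.End.HasEigenvalue (Matrix.toLin' A) b

end

noncomputable section

universe u

/-! ## Transcendence rank and Krull dimension -/

/-! The dimension of an irreducible closed set is the transcendence degree of the coordinates of its
generic point, so every dimension bound here is a parameter count over an extension field `L` of
`K`. The bound in size `m` is `UpperPairBound K m`: commuting triangular pairs over `L` have at most
`m (m + 3) / 2` independent entries.

If `X` has two different diagonal entries, a polynomial in `X` is an idempotent `E` separating the
corresponding generalized eigenspaces, of dimensions `a` and `c`. A triangular change of basis built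
from `E` makes `X` and `Y` block diagonal. `E` costs at most `a c` parameters and the blocks obey
the bounds in sizes `a` and `c`; the sum is exactly the bound in size `a + c`
(`transRank_le_of_diag_ne`). If `p` lies in a component `Z`, the unequal diagonal entries of `p`
remain unequal at the generic point of `Z`, so this applies with `a, c ≤ n - 1`.

The bounds in sizes at most `n - 1` come from the hypothesis. Near a pair whose first matrix has
distinct diagonal entries, `CT_m` has dimension at most `m (m + 3) / 2`; Krull's height theorem at
such a point bounds the number of equations below, and for a complete intersection this bounds the
dimension (`IsCompleteIntersection.varietyDim_CT_le`). Bordering a pair by a generic row and column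
then carries the bound from `m + 1` down to `m` (`UpperPairBound.of_succ`). -/

open AlgebraicIndependent in
/-- The field of elements of `L` which are algebraic over `K(S)`. -/
def algebraicSpan (K : Type*) {L : Type*} [Field K] [Field L] [Algebra K L] (S : Set L) :
    IntermediateField K L where
  carrier := (matroid K L).closure S
  mul_mem' {a b} ha hb := by
    rw [matroid_closure_eq] at *
    exact mul_mem ha hb
  add_mem' {a b} ha hb := by
    rw [matroid_closure_eq] at *
    exact add_mem ha hb
  algebraMap_mem' r := by
    rw [matroid_closure_eq]
    exact isAlgebraic_algebraMap (algebraMap K (Algebra.adjoin K S) r)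
  inv_mem' a ha := by
    rw [matroid_closure_eq] at *
    exact IsAlgebraic.inv ha

/-- The transcendence degree over `K` of the field generated by a subset of an extension `L`. -/
def transRank (K : Type*) {L : Type*} [Field K] [Field L] [Algebra K L] (S : Set L) : ℕ∞ :=
  (AlgebraicIndependent.matroid K L).eRk S

section transRank

variable {K L : Type*} [Field K] [Field L] [Algebra K L]

theorem subset_algebraicSpan (S : Set L) : S ⊆ algebraicSpan K S :=
  (AlgebraicIndependent.matroid K L).subset_closure S

theorem mem_algebraicSpan {S : Set L} {a : L} (h : a ∈ S) : a ∈ algebraicSpan K S :=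
  subset_algebraicSpan S h

theorem isAlgebraic_of_mem_algebraicSpan_iff {S : Set L} {a : L} :
    a ∈ algebraicSpan K S ↔ IsAlgebraic (Algebra.adjoin K S) a := by
  change a ∈ (AlgebraicIndependent.matroid K L).closure S ↔ _
  rw [AlgebraicIndependent.matroid_closure_eq]
  rfl

theorem transRank_mono {S T : Set L} (h : S ⊆ T) : transRank K S ≤ transRank K T :=
  (AlgebraicIndependent.matroid K L).eRk_mono h

/-- The tool for all parameter counts: since `algebraicSpan K T` is a field, quantities obtained
from `T` by field operations add nothing to the rank. -/
theorem transRank_le_of_subset_algebraicSpan {S T : Set L} (h : S ⊆ algebraicSpan K T) :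
    transRank K S ≤ transRank K T :=
  ((AlgebraicIndependent.matroid K L).eRk_mono h).trans
    ((AlgebraicIndependent.matroid K L).eRk_closure_eq T).le

theorem transRank_union_le (S T : Set L) :
    transRank K (S ∪ T) ≤ transRank K S + transRank K T :=
  (AlgebraicIndependent.matroid K L).eRk_union_le_eRk_add_eRk S T

theorem transRank_le_encard (S : Set L) : transRank K S ≤ S.encard :=
  (AlgebraicIndependent.matroid K L).eRk_le_encard S

end transRank

/-- Incomparability keeps chains of primes strict under contraction; lying over and going up lift
chains from `R` to `S`. -/
theorem ringKrullDim_eq_of_isIntegral (R S : Type*) [CommRing R] [CommRing S] [Algebra R S]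
    [Algebra.IsIntegral R S] [FaithfulSMul R S] : ringKrullDim S = ringKrullDim R := by
  apply le_antisymm
  · refine Order.krullDim_le_of_strictMono (PrimeSpectrum.comap (algebraMap R S)) ?_
    intro p q hpq
    exact Ideal.IsIntegral.comap_lt_comap (I := p.asIdeal) (J := q.asIdeal) hpq
  · refine iSup_le fun l => ?_
    obtain ⟨⟨Q, hQ, hQl⟩⟩ := Ideal.nonempty_primesOver (S := S) l.head.asIdeal
    obtain ⟨l', hl', -⟩ := Ideal.exists_ltSeries_of_hasGoingUp l Q
    rw [← hl']
    exact Order.LTSeries.length_le_krullDim l'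

/-- By Noether normalization `A` is integral over a polynomial ring in `s` variables. Their images
in `L` are independent, and the image of `A` is algebraic over them, so both sides equal `s`. -/
theorem ringKrullDim_eq_transRank_range {K A L : Type*} [Field K] [CommRing A] [Algebra K A]
    [Nontrivial A] [Algebra.FiniteType K A] [Field L] [Algebra K L] (φ : A →ₐ[K] L)
    (hφ : Function.Injective φ) :
    ringKrullDim A = (transRank K (Set.range φ) : WithBot ℕ∞) := by
  obtain ⟨s, g, hg, hint⟩ := exists_integral_inj_algHom_of_fg K A
  have h1 : ringKrullDim A = (s : WithBot ℕ∞) := by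
    algebraize [g.toRingHom]
    have : FaithfulSMul (MvPolynomial (Fin s) K) A :=
      (faithfulSMul_iff_algebraMap_injective _ _).mpr hg
    rw [ringKrullDim_eq_of_isIntegral (MvPolynomial (Fin s) K) A,
      MvPolynomial.ringKrullDim_of_isNoetherianRing, ringKrullDim_eq_zero_of_field]
    simp
  let y : Fin s → L := fun i => φ (g (MvPolynomial.X i))
  have hy : AlgebraicIndependent K y :=
    (MvPolynomial.algebraicIndependent_X (Fin s) K).map' (f := φ.comp g)
      (by simpa using hφ.comp hg)
  have hsub : Set.range y ⊆ Set.range φ := by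
    rintro _ ⟨i, rfl⟩
    exact ⟨_, rfl⟩
  have hspan : Set.range φ ⊆ algebraicSpan K (Set.range y) := by
    rintro _ ⟨a, rfl⟩
    obtain ⟨p, hp, hpa⟩ := hint a
    rw [SetLike.mem_coe, isAlgebraic_of_mem_algebraicSpan_iff]
    have hmem : ∀ q : MvPolynomial (Fin s) K, φ (g q) ∈ Algebra.adjoin K (Set.range y) := by
      intro q
      rw [Algebra.adjoin_range_eq_range_aeval]
      refine ⟨q, ?_⟩
      have : MvPolynomial.aeval y = φ.comp g := by
        ext i; simp [y]
      simp [this]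
    let ψ : MvPolynomial (Fin s) K →+* Algebra.adjoin K (Set.range y) :=
      ((φ.comp g : MvPolynomial (Fin s) K →ₐ[K] L) : MvPolynomial (Fin s) K →+* L).codRestrict
        (Algebra.adjoin K (Set.range y)) hmem
    have hI : IsIntegral (Algebra.adjoin K (Set.range y)) (φ a) := by
      refine ⟨p.map ψ, hp.map ψ, ?_⟩
      rw [Polynomial.eval₂_map]
      have h2 : (algebraMap (Algebra.adjoin K (Set.range y)) L).comp ψ
          = (φ : A →+* L).comp (g : MvPolynomial (Fin s) K →+* A) := by
        ext <;> rfl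
      rw [h2]
      have h3 := congrArg (φ : A →+* L) hpa
      rw [Polynomial.hom_eval₂, map_zero] at h3
      exact h3
    exact hI.isAlgebraic
  have h2 : transRank K (Set.range φ) = s := by
    apply le_antisymm
    · refine (transRank_le_of_subset_algebraicSpan hspan).trans ((transRank_le_encard _).trans ?_)
      rw [← Set.image_univ]
      refine (Set.encard_image_le _ _).trans ?_
      simp
    · refine le_trans ?_ (transRank_mono hsub)
      have hI : (AlgebraicIndependent.matroid K L).Indep (Set.range y) :=
        AlgebraicIndependent.matroid_indep_iff.mpr
          (AlgebraicIndependent.to_subtype_range hy)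
      rw [transRank, hI.eRk_eq_encard, ← Set.image_univ, hy.injective.encard_image]
      simp
  rw [h1, h2]
  rfl

theorem ringKrullDim_quotient_ker_aeval {K L σ : Type*} [Field K] [Finite σ] [Field L]
    [Algebra K L] (x : σ → L) :
    ringKrullDim (MvPolynomial σ K ⧸ RingHom.ker (MvPolynomial.aeval (R := K) x)) =
      (transRank K (Set.range x) : WithBot ℕ∞) := by
  have : Nontrivial (MvPolynomial σ K ⧸ RingHom.ker (MvPolynomial.aeval (R := K) x)) :=
    Ideal.Quotient.nontrivial_iff.mpr (RingHom.ker_ne_top _)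
  rw [ringKrullDim_eq_transRank_range (Ideal.kerLiftAlg (MvPolynomial.aeval (R := K) x))
    (Ideal.kerLiftAlg_injective _)]
  congr 1
  apply le_antisymm
  · refine transRank_le_of_subset_algebraicSpan ?_
    rintro _ ⟨a, rfl⟩
    obtain ⟨a, rfl⟩ := Ideal.Quotient.mk_surjective a
    have h : MvPolynomial.aeval x a ∈ Algebra.adjoin K (Set.range x) := by
      rw [Algebra.adjoin_range_eq_range_aeval]
      exact ⟨a, rfl⟩
    rw [SetLike.mem_coe, isAlgebraic_of_mem_algebraicSpan_iff]
    exact isAlgebraic_algebraMap (⟨_, h⟩ : Algebra.adjoin K (Set.range x))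
  · refine transRank_mono ?_
    rintro _ ⟨i, rfl⟩
    exact ⟨Ideal.Quotient.mk _ (MvPolynomial.X i), by simp⟩

/-! ## Affine space -/

section AffineSpace

variable {K σ : Type*} [Field K]

theorem isClosed_zariski_zero (f : MvPolynomial σ K) :
    @IsClosed _ (zariskiTopology K σ) {x | MvPolynomial.eval x f = 0} := by
  let := zariskiTopology K σ
  rw [← isOpen_compl_iff]
  refine ⟨{f}, ?_⟩
  simp

theorem isPrime_vanishingIdeal_of_isIrreducible {Z : Set (σ → K)}
    (hZ : @IsIrreducible _ (zariskiTopology K σ) Z) :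
    (MvPolynomial.vanishingIdeal K Z).IsPrime := by
  let := zariskiTopology K σ
  refine Ideal.isPrime_iff.mpr ⟨?_, ?_⟩
  · intro h
    obtain ⟨x, hx⟩ := hZ.1
    have h1 : (1 : MvPolynomial σ K) ∈ MvPolynomial.vanishingIdeal K Z := by rw [h]; trivial
    simpa using h1 x hx
  · intro f g hfg
    have := (isPreirreducible_iff_isClosed_union_isClosed.mp hZ.2) _ _
      (isClosed_zariski_zero f) (isClosed_zariski_zero g) (fun x hx => by
        simpa [MvPolynomial.aeval_eq_eval] using hfg x hx)
    simpa [MvPolynomial.aeval_eq_eval, Set.subset_def] using this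

/-- Translation of affine space, on coordinate rings. -/
def translationEquiv (a : σ → K) : MvPolynomial σ K ≃+* MvPolynomial σ K :=
  (AlgEquiv.ofAlgHom
    (MvPolynomial.aeval fun i => MvPolynomial.X i + MvPolynomial.C (a i))
    (MvPolynomial.aeval fun i => MvPolynomial.X i - MvPolynomial.C (a i))
    (by ext i; simp) (by ext i; simp) : MvPolynomial σ K ≃ₐ[K] MvPolynomial σ K).toRingEquiv

theorem comap_translationEquiv (a x : σ → K) :
    (MvPolynomial.vanishingIdeal K {x}).comap (translationEquiv a) =
      MvPolynomial.vanishingIdeal K {x + a} := by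
  ext f
  have h : (MvPolynomial.aeval (R := K) x).comp
      (MvPolynomial.aeval fun i => MvPolynomial.X i + MvPolynomial.C (a i)) =
      MvPolynomial.aeval (R := K) (x + a) := by
    ext i; simp
  rw [Ideal.mem_comap, MvPolynomial.mem_vanishingIdeal_singleton_iff,
    MvPolynomial.mem_vanishingIdeal_singleton_iff, ← h]
  rfl

/-- Some maximal ideal attains the dimension of the polynomial ring. By the Nullstellensatz it is
the ideal of a point, and translations carry it to every other point. -/
theorem height_vanishingIdeal_singleton [IsAlgClosed K] [Fintype σ] (x : σ → K) :
    (MvPolynomial.vanishingIdeal K {x}).height = Fintype.card σ := by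
  have hd : ringKrullDim (MvPolynomial σ K) = (Fintype.card σ : WithBot ℕ∞) := by
    rw [MvPolynomial.ringKrullDim_of_isNoetherianRing, ringKrullDim_eq_zero_of_field]
    simp
  have : FiniteRingKrullDim (MvPolynomial σ K) := by
    rw [finiteRingKrullDim_iff_ne_bot_and_top, hd]
    exact ⟨WithBot.coe_ne_bot, fun h => ENat.natCast_ne_top _ (WithBot.coe_injective h)⟩
  obtain ⟨P, hP, hPd⟩ := Ideal.exists_isMaximal_height (R := MvPolynomial σ K)
  obtain ⟨y, rfl⟩ := MvPolynomial.isMaximal_iff_eq_vanishingIdeal_singleton.mp hP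
  have h := (translationEquiv (x - y)).height_comap (MvPolynomial.vanishingIdeal K {y})
  rw [comap_translationEquiv, add_sub_cancel] at h
  rw [h]
  exact WithBot.coe_injective (hPd.trans hd)

/-- If every prime ideal between `J` and the prime ideal `M` has coheight at most `e`, then the
height of `M` is at most `e` plus the number of generators of `J`. -/
theorem height_le_of_forall_ringKrullDim_quotient_le {R : Type*} [CommRing R] [IsNoetherianRing R]
    {M : Ideal R} [M.IsPrime] (s : Set R) (hs : s ⊆ M) (e : ℕ)
    (h : ∀ P : Ideal R, P.IsPrime → s ⊆ P → P ≤ M → ringKrullDim (R ⧸ P) ≤ (e : WithBot ℕ∞)) :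
    M.height ≤ e + s.encard := by
  refine (Ideal.height_le_height_add_encard_of_subset s hs).trans ?_
  gcongr
  have hsM : Ideal.span s ≤ M := Ideal.span_le.mpr hs
  have hp : (M.map (Ideal.Quotient.mk (Ideal.span s))).IsPrime :=
    Ideal.isPrime_map_quotientMk_of_isPrime hsM
  rw [PrimeSpectrum.height_eq_orderHeight ⟨_, hp⟩]
  refine Order.height_le fun l hl => ?_
  have hmono : StrictMono
      (PrimeSpectrum.comap (Ideal.Quotient.mk (Ideal.span s))) := by
    intro p q hpq
    have := (Ideal.primeSpectrumQuotientOrderIsoZeroLocus (Ideal.span s)).strictMono hpq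
    exact this
  -- Pulled back to `R`, the chain starts at a prime containing `s` and ends at `M`, so its length
  -- is at most the coheight of its first term.
  let l' := l.map _ hmono
  have hhead : s ⊆ (l'.head.asIdeal : Set R) := by
    intro a ha
    have : Ideal.Quotient.mk (Ideal.span s) a = 0 :=
      Ideal.Quotient.eq_zero_iff_mem.mpr (Ideal.subset_span ha)
    change Ideal.Quotient.mk (Ideal.span s) a ∈ l.head.asIdeal
    rw [this]
    exact zero_mem _
  have hlast : l'.head.asIdeal ≤ M := by
    have h1 : l'.head ≤ l'.last := LTSeries.head_le_last l'
    have h2 : l'.last.asIdeal = M := by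
      change (l.last.asIdeal).comap _ = M
      rw [hl]
      change (M.map (Ideal.Quotient.mk (Ideal.span s))).comap _ = M
      rw [Ideal.comap_map_of_surjective _ Ideal.Quotient.mk_surjective, ← RingHom.ker_eq_comap_bot,
        Ideal.mk_ker, sup_eq_left]
      exact hsM
    exact h2 ▸ h1
  have h3 := h l'.head.asIdeal l'.head.2 hhead hlast
  rw [ringKrullDim_quotient] at h3
  have h4 : ((l'.length : ℕ∞) : WithBot ℕ∞) ≤ ((e : ℕ∞) : WithBot ℕ∞) := by
    refine le_trans ?_ h3
    refine (WithBot.coe_le_coe.mpr (Order.length_le_coheight_head (p := l'))).trans ?_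
    rw [Order.coheight_eq_krullDim_Ici]
    refine Order.krullDim_le_of_strictMono
      (fun q => ⟨q.1, fun a ha => q.2 ha⟩) (fun p q hpq => hpq)
  exact WithBot.coe_le_coe.mp h4

end AffineSpace

/-! ## Matrices over an extension field -/

/-- The set of entries of a matrix. -/
def matEntries {ι L : Type*} (M : Matrix ι ι L) : Set L := Set.range fun q : ι × ι => M q.1 q.2

theorem matEntries_subset_iff {ι L : Type*} {M : Matrix ι ι L} {S : Set L} :
    matEntries M ⊆ S ↔ ∀ i j, M i j ∈ S := by
  simp [matEntries, Set.range_subset_iff]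

section EntriesIn

variable {K L ι : Type*} [Field K] [Field L] [Algebra K L] [Fintype ι]
  {F : IntermediateField K L} {M N : Matrix ι ι L}

theorem IntermediateField.matrix_mul_apply_mem (hM : ∀ i j, M i j ∈ F) (hN : ∀ i j, N i j ∈ F)
    (i j : ι) : (M * N) i j ∈ F := by
  rw [Matrix.mul_apply]
  exact sum_mem fun k _ => mul_mem (hM i k) (hN k j)

theorem IntermediateField.det_mem [DecidableEq ι] (hM : ∀ i j, M i j ∈ F) : M.det ∈ F := by
  rw [Matrix.det_apply]
  refine sum_mem fun σ _ => ?_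
  rw [Units.smul_def]
  exact zsmul_mem (prod_mem fun i _ => hM _ _) _

theorem IntermediateField.matrix_inv_apply_mem [DecidableEq ι] (hM : ∀ i j, M i j ∈ F)
    (i j : ι) : M⁻¹ i j ∈ F := by
  rw [Matrix.inv_def, Matrix.smul_apply, smul_eq_mul, Ring.inverse_eq_inv', Matrix.adjugate_apply]
  refine mul_mem (inv_mem (IntermediateField.det_mem hM)) (IntermediateField.det_mem fun k l => ?_)
  by_cases hk : k = j
  · subst hk
    by_cases hl : l = i
    · subst hl
      simp
    · simp [hl]
  · simp [Matrix.updateRow_apply, hk, hM]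

end EntriesIn

theorem commute_aeval_of_commute {R A : Type*} [CommRing R] [Ring A] [Algebra R A] {M N : A}
    (h : Commute M N) (f : Polynomial R) : Commute (Polynomial.aeval M f) N := by
  induction f using Polynomial.induction_on with
  | C a =>
    rw [Polynomial.aeval_C]
    exact Algebra.commutes a N
  | add f g hf hg =>
    rw [map_add]
    exact hf.add_left hg
  | monomial n a hn =>
    rw [pow_succ, ← mul_assoc, map_mul, Polynomial.aeval_X]
    exact hn.mul_left h

/-! ### Triangular matrices, spectral idempotents and elimination. -/

section Triangular

variable {R ι : Type*} [CommRing R] [Fintype ι] [DecidableEq ι] {b : ι → ℕ}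

/-- An injective `b` stands for a linear order on the indices. It restricts to subtypes and extends
to `ι ⊕ Unit`, so blocks and bordered matrices need no renumbering. -/
theorem Matrix.BlockTriangular.charpoly_of_injective (hb : Function.Injective b)
    {M : Matrix ι ι R} (hM : M.BlockTriangular b) :
    M.charpoly = ∏ i, (Polynomial.X - Polynomial.C (M i i)) := by
  let := LinearOrder.lift' b hb
  exact Matrix.charpoly_of_isUpperTriangular M fun i j h => hM h

theorem Matrix.BlockTriangular.det_of_injective (hb : Function.Injective b)
    {M : Matrix ι ι R} (hM : M.BlockTriangular b) : M.det = ∏ i, M i i := by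
  let := LinearOrder.lift' b hb
  exact Matrix.det_of_isUpperTriangular fun i j h => hM h

omit [DecidableEq ι] in
theorem Matrix.BlockTriangular.mul_apply_self (hb : Function.Injective b)
    {M N : Matrix ι ι R} (hM : M.BlockTriangular b) (hN : N.BlockTriangular b) (i : ι) :
    (M * N) i i = M i i * N i i := by
  rw [Matrix.mul_apply]
  refine Finset.sum_eq_single_of_mem i (Finset.mem_univ i) fun k _ hk => ?_
  rcases lt_or_gt_of_ne (hb.ne hk) with h | h
  · rw [hM h, zero_mul]
  · rw [hN h, mul_zero]

theorem Matrix.BlockTriangular.aeval_and_apply_self (hb : Function.Injective b)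
    {M : Matrix ι ι R} (hM : M.BlockTriangular b) (f : Polynomial R) :
    (Polynomial.aeval M f).BlockTriangular b ∧
      ∀ i, Polynomial.aeval M f i i = f.eval (M i i) := by
  induction f using Polynomial.induction_on with
  | C a =>
    rw [Polynomial.aeval_C, Matrix.algebraMap_eq_diagonal]
    exact ⟨Matrix.blockTriangular_diagonal _, fun i => by simp⟩
  | add f g hf hg =>
    rw [map_add]
    exact ⟨hf.1.add hg.1, fun i => by rw [Matrix.add_apply, hf.2, hg.2, Polynomial.eval_add]⟩
  | monomial n a h =>
    rw [pow_succ, ← mul_assoc, map_mul, Polynomial.aeval_X]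
    refine ⟨h.1.mul hM, fun i => ?_⟩
    rw [h.1.mul_apply_self hb hM, h.2]
    simp

end Triangular

section Projection

variable {L ι : Type*} [Field L] [Fintype ι] [DecidableEq ι] {b : ι → ℕ}

/-- The projection onto the sum of the generalized eigenspaces belonging to a set of diagonal
entries of a triangular matrix. -/
theorem exists_idempotent_of_diag_ne (hb : Function.Injective b) {X : Matrix ι ι L}
    (hX : X.BlockTriangular b) (p : ι → Prop) [DecidablePred p]
    (hsep : ∀ i j, p i → ¬ p j → X i i ≠ X j j) :
    ∃ f : Polynomial L, Polynomial.aeval X f * Polynomial.aeval X f = Polynomial.aeval X f ∧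
      ∀ i, Polynomial.aeval X f i i = if p i then 1 else 0 := by
  let f : Polynomial L := ∏ i with p i, (Polynomial.X - Polynomial.C (X i i))
  let g : Polynomial L := ∏ i with ¬ p i, (Polynomial.X - Polynomial.C (X i i))
  have hfg : f * g = X.charpoly := by
    rw [hX.charpoly_of_injective hb]
    exact Finset.prod_filter_mul_prod_filter_not _ _ _
  have hcop : IsCoprime f g := by
    refine IsCoprime.prod_left fun i hi => IsCoprime.prod_right fun j hj => ?_
    refine Polynomial.isCoprime_X_sub_C_of_isUnit_sub (isUnit_iff_ne_zero.mpr ?_)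
    exact sub_ne_zero.mpr (hsep i j (by simpa using hi) (by simpa using hj))
  obtain ⟨u, v, huv⟩ := hcop
  -- With `u f + v g = 1`, the polynomial `v g` is idempotent modulo `f g`, the characteristic
  -- polynomial; it is `1` at the roots of `f` and `0` at those of `g`.
  refine ⟨v * g, ?_, fun i => ?_⟩
  · have h1 : v * g * (v * g) = v * g - u * v * X.charpoly := by
      rw [← hfg]
      linear_combination (v * g) * huv
    rw [← map_mul, h1, map_sub, map_mul _ (u * v), Matrix.aeval_self_charpoly, mul_zero, sub_zero]
  · rw [(hX.aeval_and_apply_self hb _).2]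
    have hroot : ∀ (q : ι → Prop) [DecidablePred q], q i →
        (∏ k with q k, (Polynomial.X - Polynomial.C (X k k))).eval (X i i) = 0 := by
      intro q _ hq
      rw [Polynomial.eval_prod]
      exact Finset.prod_eq_zero (i := i) (by simpa using hq) (by simp)
    split_ifs with hi
    · have h2 := congrArg (Polynomial.eval (X i i)) huv
      rw [Polynomial.eval_add, Polynomial.eval_mul, hroot p hi] at h2
      simpa using h2
    · rw [Polynomial.eval_mul, hroot (fun k => ¬ p k) hi, mul_zero]

end Projection

section Elimination

variable {K L ι : Type*} [Field K] [Field L] [Algebra K L] [Fintype ι] [DecidableEq ι]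
  {b : ι → ℕ} {F : IntermediateField K L}

/-- The entries of a triangular idempotent matrix with diagonal entries `0` and `1` are
determined by those in positions with different diagonal entries. -/
theorem IntermediateField.idempotent_apply_mem (hb : Function.Injective b) {M : Matrix ι ι L}
    (hM : M.BlockTriangular b) (hid : M * M = M) (p : ι → Prop) [DecidablePred p]
    (hdiag : ∀ i, M i i = if p i then 1 else 0)
    (hF : ∀ i j, b i < b j → ¬ (p i ↔ p j) → M i j ∈ F) (i j : ι) : M i j ∈ F := by
  induction h : b j - b i using Nat.strong_induction_on generalizing i j with
  | _ d ih =>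
  rcases lt_trichotomy (b j) (b i) with hij | hij | hij
  · rw [hM hij]
    exact zero_mem F
  · rw [hb hij, hdiag]
    split_ifs
    · exact one_mem F
    · exact zero_mem F
  · by_cases hp : p i ↔ p j
    swap
    · exact hF i j hij hp
    have hne : i ≠ j := fun h => by simp [h] at hij
    -- In `M * M = M`, the coefficient `1 - M i i - M j j` of `M i j` is `-1` or `1` when `p i ↔ p
    -- j`; the remaining terms involve only entries nearer the diagonal.
    have h1 : M i j = M i i * M i j + M i j * M j j +
        ∑ k ∈ (Finset.univ.erase i).erase j, M i k * M k j := by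
      conv_lhs => rw [← hid, Matrix.mul_apply, ← Finset.add_sum_erase _ _ (Finset.mem_univ i),
        ← Finset.add_sum_erase (Finset.univ.erase i) _ (Finset.mem_erase.mpr
          ⟨hne.symm, Finset.mem_univ j⟩)]
      ring
    have h2 : ∑ k ∈ (Finset.univ.erase i).erase j, M i k * M k j ∈ F := by
      refine sum_mem fun k hk => ?_
      simp only [Finset.mem_erase, Finset.mem_univ, and_true] at hk
      rcases lt_or_gt_of_ne (hb.ne hk.2) with hk1 | hk1
      · rw [hM hk1, zero_mul]
        exact zero_mem F
      rcases lt_or_gt_of_ne (hb.ne hk.1) with hk2 | hk2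
      · exact mul_mem (ih _ (by omega) i k rfl) (ih _ (by omega) k j rfl)
      · rw [hM hk2, mul_zero]
        exact zero_mem F
    rw [hdiag i, hdiag j] at h1
    by_cases hi : p i
    · have hj := hp.mp hi
      simp only [hi, hj, if_true] at h1
      have : M i j = -∑ k ∈ (Finset.univ.erase i).erase j, M i k * M k j := by
        linear_combination -h1
      rw [this]
      exact neg_mem h2
    · have hj : ¬ p j := fun h => hi (hp.mpr h)
      simp only [hi, hj, if_false, zero_mul, mul_zero, zero_add] at h1
      rw [h1]
      exact h2

/-- A triangular matrix which commutes with a triangular matrix `X` with distinct diagonal entries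
is determined by `X` and its diagonal. -/
theorem IntermediateField.apply_mem_of_commute (hb : Function.Injective b) {X Y : Matrix ι ι L}
    (hX : X.BlockTriangular b) (hY : Y.BlockTriangular b) (hXY : X * Y = Y * X)
    (hdist : ∀ i j, i ≠ j → X i i ≠ X j j) (hFX : ∀ i j, X i j ∈ F) (hFY : ∀ i, Y i i ∈ F)
    (i j : ι) : Y i j ∈ F := by
  induction h : b j - b i using Nat.strong_induction_on generalizing i j with
  | _ d ih =>
  rcases lt_trichotomy (b j) (b i) with hij | hij | hij
  · rw [hY hij]
    exact zero_mem F
  · rw [hb hij]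
    exact hFY i
  · have hne : i ≠ j := fun h => by simp [h] at hij
    have h1 := congrFun (congrFun hXY i) j
    rw [Matrix.mul_apply, Matrix.mul_apply, ← Finset.add_sum_erase _ _ (Finset.mem_univ i),
      ← Finset.add_sum_erase (Finset.univ) (fun k => Y i k * X k j) (Finset.mem_univ j)] at h1
    have h2 : ∑ k ∈ Finset.univ.erase i, X i k * Y k j ∈ F := by
      refine sum_mem fun k hk => ?_
      rcases lt_or_gt_of_ne (hb.ne (Finset.ne_of_mem_erase hk)) with hk1 | hk1
      · rw [hX hk1, zero_mul]
        exact zero_mem F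
      · exact mul_mem (hFX i k) (ih _ (by omega) k j rfl)
    have h3 : ∑ k ∈ Finset.univ.erase j, Y i k * X k j ∈ F := by
      refine sum_mem fun k hk => ?_
      rcases lt_or_gt_of_ne (hb.ne (Finset.ne_of_mem_erase hk)) with hk1 | hk1
      · exact mul_mem (ih _ (by omega) i k rfl) (hFX k j)
      · rw [hX hk1, mul_zero]
        exact zero_mem F
    -- The `(i, j)` entry of `X Y = Y X`, solved for `Y i j`; the sums contain only entries of `Y`
    -- nearer the diagonal.
    have h4 : Y i j = (∑ k ∈ Finset.univ.erase j, Y i k * X k j -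
        ∑ k ∈ Finset.univ.erase i, X i k * Y k j) * (X i i - X j j)⁻¹ := by
      rw [eq_mul_inv_iff_mul_eq₀ (sub_ne_zero.mpr (hdist i j hne))]
      linear_combination h1
    rw [h4]
    exact mul_mem (sub_mem h3 h2) (inv_mem (sub_mem (hFX i i) (hFX j j)))

end Elimination

/-! ### The parameter bound and splitting into two blocks. -/

/-- Over every extension field of `K`, the entries of a pair of commuting upper triangular
`m × m` matrices have transcendence degree at most `m (m + 3) / 2`. -/
def UpperPairBound (K : Type u) [Field K] (m : ℕ) : Prop :=
  ∀ (ι : Type) [Fintype ι] [DecidableEq ι] (b : ι → ℕ), Function.Injective b →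
    Fintype.card ι = m → ∀ (L : Type u) [Field L] [Algebra K L] (X Y : Matrix ι ι L),
    X.BlockTriangular b → Y.BlockTriangular b → X * Y = Y * X →
    transRank K (matEntries X ∪ matEntries Y) ≤ (m * (m + 3) / 2 : ℕ)

/-- The count behind the splitting: `a c` parameters for the idempotent plus those of the two
blocks. The divisions are exact because `k (k + 3)` is even. -/
theorem card_mul_add_bounds (a c : ℕ) :
    a * c + (a * (a + 3) / 2 + c * (c + 3) / 2) = (a + c) * (a + c + 3) / 2 := by
  have even : ∀ k : ℕ, 2 * (k * (k + 3) / 2) = k * (k + 3) := by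
    intro k
    refine Nat.mul_div_cancel' ?_
    rcases Nat.even_or_odd k with h | h
    · exact (h.mul_right _).two_dvd
    · exact ((h.add_odd (by decide)).mul_left _).two_dvd
  have h1 := even a
  have h2 := even c
  have h3 := even (a + c)
  have h4 : (a + c) * (a + c + 3) = 2 * (a * c) + a * (a + 3) + c * (c + 3) := by ring
  omega

section Split

variable {K : Type u} [Field K] {ι : Type} [Fintype ι] [DecidableEq ι] {b : ι → ℕ}
  {L : Type u} [Field L] [Algebra K L]

omit [DecidableEq ι] in
theorem toBlock_mul_toBlock_of_offdiag {p : ι → Prop} [DecidablePred p] {B C : Matrix ι ι L}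
    (hB : ∀ i j, p i → ¬ p j → B i j = 0) :
    (B * C).toBlock p p = B.toBlock p p * C.toBlock p p := by
  ext i j
  simp only [Matrix.toBlock_apply, Matrix.mul_apply]
  rw [← Fintype.sum_subtype_add_sum_subtype p]
  rw [add_eq_left]
  exact Finset.sum_eq_zero fun k _ => by rw [hB i k i.2 k.2, zero_mul]

theorem UpperPairBound.transRank_toBlock_le {p : ι → Prop} [DecidablePred p]
    (h : UpperPairBound K (Fintype.card {i // p i})) (hb : Function.Injective b)
    {B C : Matrix ι ι L} (hB : B.BlockTriangular b) (hC : C.BlockTriangular b)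
    (hBC : B * C = C * B) (hB0 : ∀ i j, p i → ¬ p j → B i j = 0)
    (hC0 : ∀ i j, p i → ¬ p j → C i j = 0) :
    transRank K (matEntries (B.toBlock p p) ∪ matEntries (C.toBlock p p)) ≤
      (Fintype.card {i // p i} * (Fintype.card {i // p i} + 3) / 2 : ℕ) := by
  refine h {i // p i} (fun i => b i) (fun i j hij => Subtype.ext (hb hij)) rfl L _ _
    (fun i j hij => hB hij) (fun i j hij => hC hij) ?_
  rw [← toBlock_mul_toBlock_of_offdiag hB0, ← toBlock_mul_toBlock_of_offdiag hC0, hBC]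

-- Each pair of indices from opposite groups has just one position above the diagonal, hence the
-- product of the two cardinalities.
omit [DecidableEq ι] [Field L] in
theorem encard_range_cross_le (M : Matrix ι ι L) (p : ι → Prop) [DecidablePred p] :
    {x | ∃ i j, b i < b j ∧ ¬ (p i ↔ p j) ∧ M i j = x}.encard ≤
      (Fintype.card {i // p i} * Fintype.card {i // ¬ p i} : ℕ) := by
  let f : {i // p i} × {i // ¬ p i} → L := fun q =>
    if b q.1 < b q.2 then M q.1 q.2 else M q.2 q.1
  have hsub : {x | ∃ i j, b i < b j ∧ ¬ (p i ↔ p j) ∧ M i j = x} ⊆ Set.range f := by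
    rintro _ ⟨i, j, hij, hp, rfl⟩
    by_cases hi : p i
    · exact ⟨(⟨i, hi⟩, ⟨j, fun hj => hp (by simp [hi, hj])⟩), by simp [f, hij]⟩
    · have hj : p j := by
        by_contra hj
        exact hp (by simp [hi, hj])
      exact ⟨(⟨j, hj⟩, ⟨i, hi⟩), by simp [f, hij.not_gt]⟩
  refine (Set.encard_le_encard hsub).trans ?_
  rw [← Set.image_univ]
  refine (Set.encard_image_le _ _).trans ?_
  simp [Set.encard_univ]

/-- If the diagonal entries of `X` can be divided into two groups with no common value, then the
bound for commuting pairs `X`, `Y` follows from the bounds for the two groups. -/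
theorem transRank_le_of_diag_ne (hb : Function.Injective b) {X Y : Matrix ι ι L}
    (hX : X.BlockTriangular b) (hY : Y.BlockTriangular b) (hXY : X * Y = Y * X)
    (p : ι → Prop) [DecidablePred p] (hsep : ∀ i j, p i → ¬ p j → X i i ≠ X j j)
    (h1 : UpperPairBound K (Fintype.card {i // p i}))
    (h2 : UpperPairBound K (Fintype.card {i // ¬ p i})) :
    transRank K (matEntries X ∪ matEntries Y) ≤
      (Fintype.card ι * (Fintype.card ι + 3) / 2 : ℕ) := by
  obtain ⟨f, hid, hdiag⟩ := exists_idempotent_of_diag_ne hb hX p hsep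
  set E := Polynomial.aeval X f with hE
  have hEt : E.BlockTriangular b := (hX.aeval_and_apply_self hb f).1
  have hEX : E * X = X * E := by
    exact commute_aeval_of_commute (Commute.refl X) f
  have hEY : E * Y = Y * E := by
    exact commute_aeval_of_commute hXY f
  let D : Matrix ι ι L := Matrix.diagonal fun i => if p i then 1 else 0
  have hDD : D * D = D := by
    simp only [D, Matrix.diagonal_mul_diagonal]
    congr 1
    ext i
    simp
  have hDt : D.BlockTriangular b := Matrix.blockTriangular_diagonal _
  -- The standard intertwiner of two idempotents: `E U = U D`. As `E` and `D` have the same diagonal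
  -- of zeros and ones, `U` is unitriangular. Conjugation by `U` turns matrices commuting with `E`
  -- into matrices commuting with `D`, that is, block diagonal ones.
  let U : Matrix ι ι L := E * D + (1 - E) * (1 - D)
  have h1t : (1 : Matrix ι ι L).BlockTriangular b := Matrix.blockTriangular_one
  have hUt : U.BlockTriangular b := (hEt.mul hDt).add ((h1t.sub hEt).mul (h1t.sub hDt))
  have hEU : E * U = U * D := by
    have e1 : E * U = E * D := by
      simp only [U, mul_add, ← mul_assoc, mul_sub, mul_one, hid, sub_self, zero_mul, add_zero]
    have e2 : U * D = E * D := by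
      simp only [U, add_mul, mul_assoc, sub_mul, one_mul, hDD, sub_self, mul_zero, add_zero]
    rw [e1, e2]
  have hUdet : U.det = 1 := by
    rw [hUt.det_of_injective hb]
    refine Finset.prod_eq_one fun i _ => ?_
    simp only [U, Matrix.add_apply]
    rw [hEt.mul_apply_self hb hDt, (h1t.sub hEt).mul_apply_self hb (h1t.sub hDt)]
    simp only [Matrix.sub_apply, Matrix.one_apply_eq, hdiag, D, Matrix.diagonal_apply_eq]
    split_ifs <;> simp
  have hUunit : IsUnit U.det := by rw [hUdet]; exact isUnit_one
  have hUU : U⁻¹ * U = 1 := Matrix.nonsing_inv_mul U hUunit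
  have hUU' : U * U⁻¹ = 1 := Matrix.mul_nonsing_inv U hUunit
  have : Invertible U := Matrix.invertibleOfIsUnitDet U hUunit
  have hUinv : (U⁻¹).BlockTriangular b := Matrix.blockTriangular_inv_of_blockTriangular hUt
  have hDU : U⁻¹ * E = D * U⁻¹ := by
    calc U⁻¹ * E = U⁻¹ * (E * U) * U⁻¹ := by rw [mul_assoc, mul_assoc, hUU', mul_one]
      _ = D * U⁻¹ := by rw [hEU, ← mul_assoc, hUU, one_mul]
  have key : ∀ Z : Matrix ι ι L, E * Z = Z * E → ∀ i j, ¬ (p i ↔ p j) →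
      (U⁻¹ * Z * U) i j = 0 := by
    intro Z hZ i j hij
    have hcomm : D * (U⁻¹ * Z * U) = U⁻¹ * Z * U * D := by
      calc D * (U⁻¹ * Z * U) = D * U⁻¹ * Z * U := by simp only [mul_assoc]
        _ = U⁻¹ * (E * Z) * U := by rw [← hDU]; simp only [mul_assoc]
        _ = U⁻¹ * Z * (E * U) := by rw [hZ]; simp only [mul_assoc]
        _ = U⁻¹ * Z * U * D := by rw [hEU]; simp only [mul_assoc]
    have := congrFun (congrFun hcomm i) j
    simp only [D, Matrix.diagonal_mul, Matrix.mul_diagonal] at this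
    by_cases hi : p i <;> by_cases hj : p j <;> simp_all
  set B := U⁻¹ * X * U with hB
  set C := U⁻¹ * Y * U with hC
  have hBt : B.BlockTriangular b := (hUinv.mul hX).mul hUt
  have hCt : C.BlockTriangular b := (hUinv.mul hY).mul hUt
  have conj_mul : ∀ P Q : Matrix ι ι L, U⁻¹ * P * U * (U⁻¹ * Q * U) = U⁻¹ * (P * Q) * U := by
    intro P Q
    calc U⁻¹ * P * U * (U⁻¹ * Q * U) = U⁻¹ * P * (U * U⁻¹) * Q * U := by simp only [mul_assoc]
      _ = U⁻¹ * (P * Q) * U := by rw [hUU']; simp only [mul_assoc, one_mul]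
  have hBC : B * C = C * B := by rw [hB, hC, conj_mul, conj_mul, hXY]
  have hb1 := h1.transRank_toBlock_le hb hBt hCt hBC
    (fun i j hi hj => key X hEX i j (by tauto)) (fun i j hi hj => key Y hEY i j (by tauto))
  have hb2 := h2.transRank_toBlock_le hb hBt hCt hBC
    (fun i j hi hj => key X hEX i j (by tauto)) (fun i j hi hj => key Y hEY i j (by tauto))
  set T : Set L := {x | ∃ i j, b i < b j ∧ ¬ (p i ↔ p j) ∧ E i j = x}
  set S1 := matEntries (B.toBlock p p) ∪ matEntries (C.toBlock p p)
  set S2 := matEntries (B.toBlock (fun i => ¬ p i) (fun i => ¬ p i)) ∪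
    matEntries (C.toBlock (fun i => ¬ p i) (fun i => ¬ p i))
  -- The cross entries `T` determine `E`, hence `U`; with the blocks of `B` and `C` they determine
  -- `X` and `Y`.
  let F := algebraicSpan K (T ∪ (S1 ∪ S2))
  have hTF : ∀ x ∈ T, x ∈ F := fun x hx => mem_algebraicSpan (Or.inl hx)
  have hEF : ∀ i j, E i j ∈ F := IntermediateField.idempotent_apply_mem hb hEt hid p hdiag
    fun i j hij hp => hTF _ ⟨i, j, hij, hp, rfl⟩
  have h1F : ∀ i j, (1 : Matrix ι ι L) i j ∈ F := fun i j => by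
    rw [Matrix.one_apply]
    split_ifs
    exacts [one_mem F, zero_mem F]
  have hDF : ∀ i j, D i j ∈ F := fun i j => by
    simp only [D, Matrix.diagonal_apply]
    split_ifs
    exacts [one_mem F, zero_mem F, zero_mem F]
  have hUF : ∀ i j, U i j ∈ F := fun i j => add_mem
    (IntermediateField.matrix_mul_apply_mem hEF hDF i j)
    (IntermediateField.matrix_mul_apply_mem (fun i j => sub_mem (h1F i j) (hEF i j))
      (fun i j => sub_mem (h1F i j) (hDF i j)) i j)
  have block : ∀ Z : Matrix ι ι L, (∀ i j, ¬ (p i ↔ p j) → Z i j = 0) →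
      (∀ i j : {i // p i}, Z i j ∈ F) → (∀ i j : {i // ¬ p i}, Z i j ∈ F) →
      ∀ i j, Z i j ∈ F := by
    intro Z h0 hp hn i j
    by_cases hij : p i ↔ p j
    · by_cases hi : p i
      · exact hp ⟨i, hi⟩ ⟨j, hij.mp hi⟩
      · exact hn ⟨i, hi⟩ ⟨j, fun h => hi (hij.mpr h)⟩
    · rw [h0 i j hij]
      exact zero_mem F
  have hBF : ∀ i j, B i j ∈ F := block B (key X hEX)
    (fun i j => mem_algebraicSpan (.inr (.inl (.inl ⟨(i, j), rfl⟩))))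
    (fun i j => mem_algebraicSpan (.inr (.inr (.inl ⟨(i, j), rfl⟩))))
  have hCF : ∀ i j, C i j ∈ F := block C (key Y hEY)
    (fun i j => mem_algebraicSpan (.inr (.inl (.inr ⟨(i, j), rfl⟩))))
    (fun i j => mem_algebraicSpan (.inr (.inr (.inr ⟨(i, j), rfl⟩))))
  have back : ∀ Z : Matrix ι ι L, (∀ i j, (U⁻¹ * Z * U) i j ∈ F) → ∀ i j, Z i j ∈ F := by
    intro Z hZ
    have : Z = U * (U⁻¹ * Z * U) * U⁻¹ := by
      calc Z = (U * U⁻¹) * Z * (U * U⁻¹) := by rw [hUU', one_mul, mul_one]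
        _ = U * (U⁻¹ * Z * U) * U⁻¹ := by simp only [mul_assoc]
    rw [this]
    exact IntermediateField.matrix_mul_apply_mem
      (IntermediateField.matrix_mul_apply_mem hUF hZ) (IntermediateField.matrix_inv_apply_mem hUF)
  have hsub : matEntries X ∪ matEntries Y ⊆ F := Set.union_subset
    (matEntries_subset_iff.mpr (back X hBF)) (matEntries_subset_iff.mpr (back Y hCF))
  calc transRank K (matEntries X ∪ matEntries Y) ≤ transRank K (T ∪ (S1 ∪ S2)) :=
        transRank_le_of_subset_algebraicSpan hsub
    _ ≤ transRank K T + (transRank K S1 + transRank K S2) :=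
        (transRank_union_le _ _).trans (by gcongr; exact transRank_union_le _ _)
    _ ≤ (Fintype.card {i // p i} * Fintype.card {i // ¬ p i} : ℕ) +
        ((Fintype.card {i // p i} * (Fintype.card {i // p i} + 3) / 2 : ℕ) +
        (Fintype.card {i // ¬ p i} * (Fintype.card {i // ¬ p i} + 3) / 2 : ℕ)) := by
        gcongr
        exact (transRank_le_encard T).trans (encard_range_cross_le E p)
    _ = (Fintype.card ι * (Fintype.card ι + 3) / 2 : ℕ) := by
        rw [← Fintype.card_congr (Equiv.sumCompl p), Fintype.card_sum, ← card_mul_add_bounds]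
        push_cast
        rfl

end Split

/-! ### Bordering: from size `m + 1` to size `m`. -/

theorem transRank_add_le_of_algebraicIndependent {K : Type*} {L M : Type*} [Field K] [Field L]
    [Field M] [Algebra K L] [Algebra K M] [Algebra L M] [IsScalarTower K L M] (S : Set L) {d : ℕ}
    {t : Fin d → M} (ht : AlgebraicIndependent L t) (T : Set M)
    (hS : algebraMap L M '' S ⊆ T) (hT : Set.range t ⊆ T) :
    transRank K S + d ≤ transRank K T := by
  obtain ⟨B, hB⟩ := (AlgebraicIndependent.matroid K L).exists_isBasis S
  have hBi : AlgebraicIndependent K ((↑) : B → L) := hB.indep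
  have h := hBi.sumElim_comp ht
  have hI : (AlgebraicIndependent.matroid K M).Indep
      (Set.range (Sum.elim t (algebraMap L M ∘ ((↑) : B → L)))) :=
    AlgebraicIndependent.matroid_indep_iff.mpr (AlgebraicIndependent.to_subtype_range h)
  have hsub : Set.range (Sum.elim t (algebraMap L M ∘ ((↑) : B → L))) ⊆ T := by
    rintro _ ⟨i | i, rfl⟩
    · exact hT ⟨i, rfl⟩
    · exact hS ⟨i, hB.subset i.2, rfl⟩
  refine le_trans ?_ (transRank_mono hsub)
  rw [transRank, transRank, hI.eRk_eq_encard, hB.eRk_eq_encard, ← Set.image_univ,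
    h.injective.encard_image, Set.encard_univ, ENat.card_sum, add_comm]
  simp

theorem exists_commute_fromBlocks {M ι : Type*} [Field M] [Fintype ι] [DecidableEq ι]
    {X Y : Matrix ι ι M} (hXY : X * Y = Y * X) (t₁ t₂ : M) (w : Matrix ι Unit M)
    (hdet : IsUnit (Matrix.scalar ι t₁ - X).det) :
    ∃ z : Matrix ι Unit M,
      Matrix.fromBlocks X w 0 (Matrix.scalar Unit t₁) *
        Matrix.fromBlocks Y z 0 (Matrix.scalar Unit t₂) =
      Matrix.fromBlocks Y z 0 (Matrix.scalar Unit t₂) *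
        Matrix.fromBlocks X w 0 (Matrix.scalar Unit t₁) := by
  -- This equation for `z` is the upper right block of the commutation relation.
  obtain ⟨z, hz⟩ : ∃ z, (Matrix.scalar ι t₁ - X) * z = (Matrix.scalar ι t₂ - Y) * w :=
    ⟨(Matrix.scalar ι t₁ - X)⁻¹ * ((Matrix.scalar ι t₂ - Y) * w), by
      rw [← Matrix.mul_assoc, Matrix.mul_nonsing_inv _ hdet, Matrix.one_mul]⟩
  refine ⟨z, ?_⟩
  have scalar_mul_comm : ∀ (v : Matrix ι Unit M) (c : M),
      v * Matrix.scalar Unit c = Matrix.scalar ι c * v := by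
    intro v c
    ext i j
    simp [mul_comm]
  have h12 : X * z + w * Matrix.scalar Unit t₂ = Y * w + z * Matrix.scalar Unit t₁ := by
    rw [Matrix.sub_mul, Matrix.sub_mul] at hz
    rw [scalar_mul_comm, scalar_mul_comm, add_comm, add_comm (Y * w)]
    exact (sub_eq_sub_iff_add_eq_add.mp hz).symm
  rw [Matrix.fromBlocks_multiply, Matrix.fromBlocks_multiply, h12, ← map_mul, ← map_mul,
    mul_comm t₁ t₂, Matrix.mul_zero, Matrix.mul_zero, hXY]
  simp

/-- Bordering `(X, Y)` by a free column `w` and free corners `t₁`, `t₂` adds `m + 2` independent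
parameters, exactly the difference of the two bounds; the second column `z` is forced. -/
theorem UpperPairBound.of_succ {K : Type u} [Field K] {m : ℕ} (h : UpperPairBound K (m + 1)) :
    UpperPairBound K m := by
  intro ι _ _ b hb hcard L _ _ X Y hX hY hXY
  let A := MvPolynomial (Fin (m + 2)) L
  let M := FractionRing A
  let t : Fin (m + 2) → M := fun i => algebraMap A M (MvPolynomial.X i)
  have ht : AlgebraicIndependent L t :=
    (MvPolynomial.algebraicIndependent_X (Fin (m + 2)) L).map'
      (f := IsScalarTower.toAlgHom L A M) (IsFractionRing.injective A M)
  let e : Fin (m + 2) ≃ ι ⊕ Fin 2 := Fintype.equivOfCardEq (by simp [hcard])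
  let s : ι ⊕ Fin 2 → M := t ∘ e.symm
  let φ : L →+* M := algebraMap L M
  let X' : Matrix ι ι M := X.map φ
  let Y' : Matrix ι ι M := Y.map φ
  let t₁ := s (Sum.inr 0)
  let t₂ := s (Sum.inr 1)
  let w : Matrix ι Unit M := Matrix.of fun i _ => s (Sum.inl i)
  have hX'Y' : X' * Y' = Y' * X' := by
    simp only [X', Y', ← Matrix.map_mul, hXY]
  -- `t₁` is transcendental over `L`, so it is no root of the characteristic polynomial of `X`.
  have hdet : IsUnit (Matrix.scalar ι t₁ - X').det := by
    rw [isUnit_iff_ne_zero, ← Matrix.eval_charpoly]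
    have htr : Transcendental L t₁ := ht.transcendental _
    rw [Matrix.charpoly_map, Polynomial.eval_map]
    intro h0
    exact htr ⟨X.charpoly, X.charpoly_monic.ne_zero, h0⟩
  obtain ⟨z, hPQ⟩ := exists_commute_fromBlocks hX'Y' t₁ t₂ w hdet
  let P : Matrix (ι ⊕ Unit) (ι ⊕ Unit) M := Matrix.fromBlocks X' w 0 (Matrix.scalar Unit t₁)
  let Q : Matrix (ι ⊕ Unit) (ι ⊕ Unit) M := Matrix.fromBlocks Y' z 0 (Matrix.scalar Unit t₂)
  let N := Finset.univ.sup b + 1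
  have hN : ∀ i, b i < N := fun i =>
    Nat.lt_succ_of_le (Finset.le_sup (f := b) (Finset.mem_univ i))
  let b' : ι ⊕ Unit → ℕ := Sum.elim b fun _ => N
  have hb' : Function.Injective b' :=
    Function.Injective.sumElim hb (fun _ _ _ => rfl) fun i _ => (hN i).ne
  have htri : ∀ (Z : Matrix ι ι L) (v : Matrix ι Unit M) (c : M), Z.BlockTriangular b →
      (Matrix.fromBlocks (Z.map φ) v 0 (Matrix.scalar Unit c)).BlockTriangular b' := by
    intro Z v c hZ i j hij
    rcases i with i | i <;> rcases j with j | j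
    · have : Z i j = 0 := hZ hij
      simp [this]
    · exact absurd hij (hN i).not_gt
    · simp
    · exact absurd hij (lt_irrefl _)
  have hmain := h (ι ⊕ Unit) b' hb' (by simp [hcard]) M P Q (htri X w t₁ hX) (htri Y z t₂ hY) hPQ
  have hadd := transRank_add_le_of_algebraicIndependent (K := K) (matEntries X ∪ matEntries Y) ht
    (matEntries P ∪ matEntries Q) (by
      rintro _ ⟨_, ⟨⟨i, j⟩, rfl⟩ | ⟨⟨i, j⟩, rfl⟩, rfl⟩
      · exact Or.inl ⟨(Sum.inl i, Sum.inl j), rfl⟩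
      · exact Or.inr ⟨(Sum.inl i, Sum.inl j), rfl⟩) (by
      rintro _ ⟨k, rfl⟩
      have hk : t k = s (e k) := by simp [s]
      rw [hk]
      rcases e k with i | i
      · exact Or.inl ⟨(Sum.inl i, Sum.inr ()), rfl⟩
      · fin_cases i
        · exact Or.inl ⟨(Sum.inr (), Sum.inr ()), by simp [P, t₁]⟩
        · exact Or.inr ⟨(Sum.inr (), Sum.inr ()), by simp [Q, t₂]⟩)
  have h1 : transRank K (matEntries X ∪ matEntries Y) + (m + 2 : ℕ) ≤
      ((m + 1) * (m + 1 + 3) / 2 : ℕ) := hadd.trans hmain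
  have h2 : (m + 1) * (m + 1 + 3) / 2 = m * (m + 3) / 2 + (m + 2) := by
    have := card_mul_add_bounds m 1
    omega
  rw [h2, Nat.cast_add] at h1
  exact (ENat.add_le_add_iff_right (ENat.natCast_ne_top _)).mp h1

theorem UpperPairBound.of_le {K : Type u} [Field K] {m n : ℕ} (h : UpperPairBound K n)
    (hmn : m ≤ n) : UpperPairBound K m := by
  induction hmn with
  | refl => exact h
  | step _ ih => exact ih h.of_succ

/-! ### The dimension of `CT_m` when it is a complete intersection. -/

theorem card_upperIdx (m : ℕ) : 2 * Fintype.card (UpperIdx m) = m * (m + 1) := by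
  have h : Fintype.card (UpperIdx m) = ∑ j : Fin m, ((j : ℕ) + 1) := by
    rw [Fintype.card_subtype, Finset.card_filter, Fintype.sum_prod_type_right]
    refine Finset.sum_congr rfl fun j _ => ?_
    rw [← Finset.card_filter, ← Fin.card_Iic]
    congr 1
    ext i
    simp
  have hsum : ∀ k : ℕ, 2 * ∑ j ∈ Finset.range k, (j + 1) = k * (k + 1) := by
    intro k
    induction k with
    | zero => simp
    | succ k ih => rw [Finset.sum_range_succ, mul_add, ih]; ring
  rw [h, Fin.sum_univ_eq_sum_range (fun j => j + 1) m, hsum]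

/-- The `m (m + 1) / 2` entries of `X` and the `m` diagonal entries of `Y` determine everything. -/
theorem transRank_le_of_distinct_diag {K L : Type*} [Field K] [Field L] [Algebra K L] {m : ℕ}
    {X Y : Matrix (Fin m) (Fin m) L} (hX : X.BlockTriangular id) (hY : Y.BlockTriangular id)
    (hXY : X * Y = Y * X) (hdist : ∀ i j, i ≠ j → X i i ≠ X j j) :
    transRank K (matEntries X ∪ matEntries Y) ≤ (m * (m + 3) / 2 : ℕ) := by
  let f : UpperIdx m ⊕ Fin m → L := Sum.elim (fun q => X q.1.1 q.1.2) (fun i => Y i i)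
  let F := algebraicSpan K (Set.range f)
  have hfF : ∀ i, f i ∈ F := fun i => mem_algebraicSpan ⟨i, rfl⟩
  have hFX : ∀ i j, X i j ∈ F := by
    intro i j
    by_cases hij : i ≤ j
    · exact hfF (Sum.inl ⟨(i, j), hij⟩)
    · rw [hX (lt_of_not_ge hij)]
      exact zero_mem F
  have hFY := IntermediateField.apply_mem_of_commute (F := F) (b := fun i : Fin m => (i : ℕ))
    Fin.val_injective (fun i j h => hX h) (fun i j h => hY h) hXY hdist hFX
    fun i => hfF (Sum.inr i)
  refine (transRank_le_of_subset_algebraicSpan (Set.union_subset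
    (matEntries_subset_iff.mpr hFX) (matEntries_subset_iff.mpr hFY))).trans ?_
  refine (transRank_le_encard _).trans ?_
  rw [← Set.image_univ]
  refine (Set.encard_image_le _ _).trans ?_
  rw [Set.encard_univ, ENat.card_eq_coe_fintype_card, Fintype.card_sum, Fintype.card_fin]
  have h1 := card_upperIdx m
  have h2 : m * (m + 3) = m * (m + 1) + 2 * m := by ring
  have h3 : Fintype.card (UpperIdx m) + m ≤ m * (m + 3) / 2 := by omega
  exact_mod_cast h3

section GenericPair

variable {K : Type*} [Field K] {n : ℕ}

theorem upperMatrix_blockTriangular (x : UpperIdx n → K) : (upperMatrix x).BlockTriangular id := by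
  have : upperMatrix x ∈ Set.range (upperMatrix : (UpperIdx n → K) → _) := ⟨x, rfl⟩
  rwa [range_upperMatrix] at this

/-- The upper triangular matrix of coordinate functions. -/
def genericUpper (K : Type*) [Field K] {n : ℕ} (f : UpperIdx n → PairIdx n) :
    Matrix (Fin n) (Fin n) (MvPolynomial (PairIdx n) K) :=
  Matrix.of fun i j => if h : i ≤ j then MvPolynomial.X (f ⟨(i, j), h⟩) else 0

/-- The entries of the commutator of the generic pair of upper triangular matrices. -/
def commutatorEntry (K : Type*) [Field K] {n : ℕ} (i j : Fin n) : MvPolynomial (PairIdx n) K :=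
  (genericUpper (n := n) K Sum.inl * genericUpper (n := n) K Sum.inr -
    genericUpper (n := n) K Sum.inr * genericUpper (n := n) K Sum.inl) i j

theorem aeval_genericUpper {L : Type*} [Field L] [Algebra K L] (f : UpperIdx n → PairIdx n)
    (x : PairIdx n → L) (i j : Fin n) :
    MvPolynomial.aeval x (genericUpper K f i j) = upperMatrix (fun q => x (f q)) i j := by
  simp only [genericUpper, upperMatrix, Matrix.of_apply]
  split_ifs <;> simp

theorem aeval_commutatorEntry {L : Type*} [Field L] [Algebra K L] (x : PairIdx n → L)
    (i j : Fin n) : MvPolynomial.aeval x (commutatorEntry K i j) =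
      (matX x * matY x - matY x * matX x) i j := by
  simp [commutatorEntry, Matrix.mul_apply, aeval_genericUpper, matX, matY]

theorem mul_eq_mul_iff_aeval_commutatorEntry {L : Type*} [Field L] [Algebra K L]
    (x : PairIdx n → L) : matX x * matY x = matY x * matX x ↔
      ∀ i j : Fin n, MvPolynomial.aeval x (commutatorEntry K i j) = 0 := by
  simp_rw [aeval_commutatorEntry, ← sub_eq_zero (a := matX x * matY x), ← Matrix.ext_iff,
    Matrix.zero_apply]

theorem commutatorEntry_mem_vanishingIdeal {V : Set (PairIdx n → K)} (hV : V ⊆ CT K n)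
    (i j : Fin n) : commutatorEntry K i j ∈ MvPolynomial.vanishingIdeal K V :=
  fun x hx => (mul_eq_mul_iff_aeval_commutatorEntry (K := K) x).mp (hV hx) i j

theorem range_subset_matEntries {L : Type*} [Field L] (x : PairIdx n → L) :
    Set.range x ⊆ matEntries (matX x) ∪ matEntries (matY x) := by
  rintro _ ⟨⟨⟨i, j⟩, h⟩ | ⟨⟨i, j⟩, h⟩, rfl⟩
  · exact Or.inl ⟨(i, j), by simp [matX, upperMatrix, show i ≤ j from h]⟩
  · exact Or.inr ⟨(i, j), by simp [matY, upperMatrix, show i ≤ j from h]⟩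

/-- By the Nullstellensatz the ideal of `CT K n` is the radical of the ideal of commutator entries,
so polynomials vanishing on the `K`-points also vanish at commuting pairs over `L`. -/
theorem vanishingIdeal_CT_le_ker [IsAlgClosed K] {L : Type*} [Field L] [Algebra K L]
    {x : PairIdx n → L} (hx : matX x * matY x = matY x * matX x) :
    MvPolynomial.vanishingIdeal K (CT K n) ≤ RingHom.ker (MvPolynomial.aeval (R := K) x) := by
  have hCT : CT K n = MvPolynomial.zeroLocus K
      (Ideal.span (Set.range fun q : Fin n × Fin n => commutatorEntry K q.1 q.2)) := by
    ext y
    rw [MvPolynomial.zeroLocus_span]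
    simp only [Set.mem_ofPred_eq, Set.forall_mem_range, Prod.forall]
    exact mul_eq_mul_iff_aeval_commutatorEntry (K := K) y
  rw [hCT, MvPolynomial.vanishingIdeal_zeroLocus_eq_radical]
  refine (RingHom.ker_isPrime _).radical_le_iff.mpr (Ideal.span_le.mpr ?_)
  rintro _ ⟨q, rfl⟩
  exact (mul_eq_mul_iff_aeval_commutatorEntry (K := K) x).mp hx q.1 q.2

end GenericPair

/-- The generic point of a prime ideal. -/
theorem exists_generic_point {K : Type u} {σ : Type} [Field K] (P : Ideal (MvPolynomial σ K)) [P.IsPrime] :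
    ∃ (L : Type u) (_ : Field L) (_ : Algebra K L) (x : σ → L),
      RingHom.ker (MvPolynomial.aeval (R := K) x) = P := by
  let A := MvPolynomial σ K ⧸ P
  let φ : MvPolynomial σ K →ₐ[K] FractionRing A :=
    (IsScalarTower.toAlgHom K A (FractionRing A)).comp (Ideal.Quotient.mkₐ K P)
  refine ⟨FractionRing A, inferInstance, inferInstance, fun i => φ (MvPolynomial.X i), ?_⟩
  have h : MvPolynomial.aeval (fun i => φ (MvPolynomial.X i)) = φ := by
    ext i; simp
  rw [h]
  ext f
  rw [RingHom.mem_ker]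
  simp [φ, A, Ideal.Quotient.eq_zero_iff_mem]

theorem matX_apply_self {K : Type*} [Field K] {n : ℕ} (x : PairIdx n → K) (i : Fin n) :
    matX x i i = x (Sum.inl ⟨(i, i), le_rfl⟩) := by
  simp [matX, upperMatrix]

theorem matY_apply_self {K : Type*} [Field K] {n : ℕ} (x : PairIdx n → K) (i : Fin n) :
    matY x i i = x (Sum.inr ⟨(i, i), le_rfl⟩) := by
  simp [matY, upperMatrix]

/-- Different coordinates of a point in the closure of a generic point `x` are different at `x`. -/
theorem ne_of_ker_aeval_le {K L σ : Type*} [Field K] [Field L] [Algebra K L] {x : σ → L}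
    {p : σ → K} (h : ∀ f : MvPolynomial σ K, MvPolynomial.aeval x f = 0 →
      MvPolynomial.aeval p f = 0) {s t : σ} (hst : p s ≠ p t) : x s ≠ x t := by
  intro hx
  have := h (MvPolynomial.X s - MvPolynomial.X t) (by simp [hx])
  rw [map_sub, MvPolynomial.aeval_X, MvPolynomial.aeval_X, sub_eq_zero] at this
  exact hst this

theorem IsCompleteIntersection.varietyDim_CT_le {K : Type u} [Field K] [IsAlgClosed K] {m : ℕ}
    (h : IsCompleteIntersection (CT K m)) :
    varietyDim (CT K m) ≤ ((m * (m + 3) / 2 : ℕ) : WithBot ℕ∞) := by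
  obtain ⟨c, f, hc, hf⟩ := h
  let a : ℕ ↪ K := Infinite.natEmbedding K
  -- The base point: a diagonal matrix with distinct entries, paired with zero. Every irreducible
  -- closed subset of `CT K m` through it has a generic first matrix with distinct diagonal entries.
  let p : PairIdx m → K := Sum.elim (fun q => if q.1.1 = q.1.2 then a q.1.1 else 0) 0
  have hpY : matY p = 0 := by
    ext i j
    simp [matY, upperMatrix, p]
  have hp : p ∈ CT K m := by
    change matX p * matY p = matY p * matX p
    rw [hpY, mul_zero, zero_mul]
  have hfp : Set.range f ⊆ MvPolynomial.vanishingIdeal K {p} := by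
    rintro _ ⟨i, rfl⟩
    rw [SetLike.mem_coe, MvPolynomial.mem_vanishingIdeal_singleton_iff]
    rw [hf] at hp
    exact hp i
  have hCT : CT K m = MvPolynomial.zeroLocus K (Ideal.span (Set.range f)) := by
    rw [MvPolynomial.zeroLocus_span, hf]
    simp [MvPolynomial.aeval_eq_eval]
  have hht := height_le_of_forall_ringKrullDim_quotient_le (Set.range f) hfp (m * (m + 3) / 2) (by
    intro P hP hfP hPM
    obtain ⟨L, _, _, x, rfl⟩ := exists_generic_point P
    rw [ringKrullDim_quotient_ker_aeval]
    have hIP : MvPolynomial.vanishingIdeal K (CT K m) ≤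
        RingHom.ker (MvPolynomial.aeval (R := K) x) := by
      rw [hCT, MvPolynomial.vanishingIdeal_zeroLocus_eq_radical]
      exact hP.radical_le_iff.mpr (Ideal.span_le.mpr hfP)
    have hx : matX x * matY x = matY x * matX x :=
      (mul_eq_mul_iff_aeval_commutatorEntry (K := K) x).mpr fun i j =>
        hIP (commutatorEntry_mem_vanishingIdeal subset_rfl i j)
    have hdist : ∀ i j, i ≠ j → matX x i i ≠ matX x j j := by
      intro i j hij
      rw [matX_apply_self, matX_apply_self]
      refine ne_of_ker_aeval_le (p := p) (fun g hg => hPM hg p rfl) ?_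
      simpa [p, Fin.val_inj] using hij
    exact WithBot.coe_le_coe.mpr ((transRank_mono (range_subset_matEntries x)).trans
      (transRank_le_of_distinct_diag (upperMatrix_blockTriangular _)
        (upperMatrix_blockTriangular _) hx hdist)))
  rw [height_vanishingIdeal_singleton] at hht
  have hcard : (Set.range f).encard ≤ c := by
    rw [← Set.image_univ]
    refine (Set.encard_image_le _ _).trans ?_
    simp
  -- The left side is also `varietyDim (CT K m) + c`; cancelling `c` gives the claim.
  have hN : (Fintype.card (PairIdx m) : ℕ∞) ≤ (m * (m + 3) / 2 : ℕ) + c :=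
    hht.trans (by gcongr)
  generalize Fintype.card (PairIdx m) = N at *
  generalize varietyDim (CT K m) = d at *
  induction d with
  | bot => exact bot_le
  | coe d =>
    have h1 : d + c = (N : ℕ∞) := WithBot.coe_injective hc
    rw [← h1] at hN
    exact WithBot.coe_le_coe.mpr
      ((ENat.add_le_add_iff_right (ENat.natCast_ne_top c)).mp hN)

/-- After ordering the indices by `b`, the pair is an `L`-point of `CT_m`; the algebra generated by
its entries is a quotient of the coordinate ring, so its dimension is no larger. -/
theorem upperPairBound_of_varietyDim_le {K : Type u} [Field K] [IsAlgClosed K] {m : ℕ}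
    (h : varietyDim (CT K m) ≤ ((m * (m + 3) / 2 : ℕ) : WithBot ℕ∞)) : UpperPairBound K m := by
  intro ι _ _ b hb hcard L _ _ X Y hX hY hXY
  let := LinearOrder.lift' b hb
  let e : Fin m ≃o ι := Fintype.orderIsoFinOfCardEq ι hcard
  have mem_range : ∀ Z : Matrix ι ι L, Z.BlockTriangular b →
      Z.submatrix e e ∈ Set.range (upperMatrix : (UpperIdx m → L) → _) := by
    intro Z hZ
    rw [range_upperMatrix]
    intro i j hij
    exact hZ (show e j < e i from e.strictMono hij)
  obtain ⟨x, hx⟩ := mem_range X hX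
  obtain ⟨y, hy⟩ := mem_range Y hY
  let z : PairIdx m → L := Sum.elim x y
  have hzX : matX z = X.submatrix e e := hx
  have hzY : matY z = Y.submatrix e e := hy
  have hz : matX z * matY z = matY z * matX z := by
    have hmul : ∀ P Q : Matrix ι ι L,
        P.submatrix e e * Q.submatrix e e = (P * Q).submatrix e e :=
      fun P Q => Matrix.submatrix_mul_equiv P Q e e.toEquiv e
    rw [hzX, hzY, hmul, hmul, hXY]
  have hdim : ((transRank K (Set.range z) : ℕ∞) : WithBot ℕ∞) ≤
      ((m * (m + 3) / 2 : ℕ) : WithBot ℕ∞) := by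
    rw [← ringKrullDim_quotient_ker_aeval]
    refine le_trans ?_ h
    exact ringKrullDim_le_of_surjective (Ideal.Quotient.factor (vanishingIdeal_CT_le_ker hz))
      (Ideal.Quotient.factor_surjective _)
  have hentry : ∀ (Z : Matrix ι ι L) (v : UpperIdx m → L), upperMatrix v = Z.submatrix e e →
      Set.range v ⊆ Set.range z → matEntries Z ⊆ algebraicSpan K (Set.range z) := by
    intro Z v hv hvz
    rw [matEntries_subset_iff]
    intro i j
    have : Z i j = upperMatrix v (e.symm i) (e.symm j) := by simp [hv]
    rw [this]
    simp only [upperMatrix, Matrix.of_apply]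
    split_ifs
    · exact mem_algebraicSpan (hvz ⟨_, rfl⟩)
    · exact zero_mem (algebraicSpan K (Set.range z))
  refine (transRank_le_of_subset_algebraicSpan (Set.union_subset (hentry X x hx ?_)
    (hentry Y y hy ?_))).trans (WithBot.coe_le_coe.mp hdim)
  · rintro _ ⟨q, rfl⟩
    exact ⟨Sum.inl q, rfl⟩
  · rintro _ ⟨q, rfl⟩
    exact ⟨Sum.inr q, rfl⟩

/-! ### Pairs with two distinct eigenvalues. -/

theorem UpperPairBound.transRank_le_of_exists_diag_ne {K : Type u} [Field K] {n : ℕ}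
    (h : UpperPairBound K (n - 1)) {L : Type u} [Field L] [Algebra K L]
    {X Y : Matrix (Fin n) (Fin n) L} (hX : X.BlockTriangular id) (hY : Y.BlockTriangular id)
    (hXY : X * Y = Y * X) (hne : ∃ i j, X i i ≠ X j j) :
    transRank K (matEntries X ∪ matEntries Y) ≤ (n * (n + 3) / 2 : ℕ) := by
  classical
  obtain ⟨i, j, hij⟩ := hne
  -- The indices are grouped by whether their diagonal entry equals `X i i`; `j` and `i` show that
  -- both groups are proper.
  have h1 : Fintype.card {k // X k k = X i i} < n := by
    simpa using Fintype.card_subtype_lt (p := fun k => X k k = X i i) hij.symm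
  have h2 : Fintype.card {k // ¬ X k k = X i i} < n := by
    simpa using Fintype.card_subtype_lt (p := fun k => ¬ X k k = X i i) (x := i) (by simp)
  have := transRank_le_of_diag_ne (K := K) (b := fun i : Fin n => (i : ℕ)) Fin.val_injective
    (fun i j h => hX h) (fun i j h => hY h) hXY (fun k => X k k = X i i)
    (fun k l hk hl hkl => hl (hkl ▸ hk)) (h.of_le (by omega)) (h.of_le (by omega))
  simpa using this

theorem HasTwoEigenvalues.exists_diag_ne {K : Type*} [Field K] {n : ℕ}
    {A : Matrix (Fin n) (Fin n) K} (h : HasTwoEigenvalues A) (hA : A.BlockTriangular id) :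
    ∃ i j, A i i ≠ A j j := by
  obtain ⟨a, b, hab, ha, hb⟩ := h
  have key : ∀ c, Module.End.HasEigenvalue (Matrix.toLin' A) c → ∃ i, A i i = c := by
    intro c hc
    rw [Module.End.hasEigenvalue_iff_isRoot_charpoly, Matrix.charpoly_toLin',
      Matrix.charpoly_of_isUpperTriangular A hA, Polynomial.IsRoot, Polynomial.eval_prod,
      Finset.prod_eq_zero_iff] at hc
    obtain ⟨i, -, hi⟩ := hc
    exact ⟨i, by simpa [sub_eq_zero, eq_comm] using hi⟩
  obtain ⟨i, rfl⟩ := key a ha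
  obtain ⟨j, rfl⟩ := key b hb
  exact ⟨i, j, hab⟩

end

theorem proposition5 {K : Type*} [Field K] [IsAlgClosed K] (n : ℕ)
    (hCI : IsCompleteIntersection (CT K (n - 1)))
    (p : PairIdx n → K) (hp : p ∈ CT K n)
    (heig : HasTwoEigenvalues (matX p) ∨ HasTwoEigenvalues (matY p))
    (Z : Set (PairIdx n → K)) (hZ : IsIrredComponent (CT K n) Z)
    (hdim : ((n * (n + 3) / 2 : ℕ) : WithBot ℕ∞) < varietyDim Z) :
    p ∉ Z := by
  intro hpZ
  refine hdim.not_ge ?_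
  have hbound := upperPairBound_of_varietyDim_le hCI.varietyDim_CT_le
  have := isPrime_vanishingIdeal_of_isIrreducible hZ.prop.2
  obtain ⟨L, _, _, x, hx⟩ := exists_generic_point (MvPolynomial.vanishingIdeal K Z)
  have hcomm : matX x * matY x = matY x * matX x :=
    (mul_eq_mul_iff_aeval_commutatorEntry (K := K) x).mpr fun i j => by
      have := commutatorEntry_mem_vanishingIdeal hZ.prop.1 i j
      rwa [← hx] at this
  -- `p` is a specialization of the generic point `x` of `Z`, so inequalities between coordinates
  -- pass from `p` to `x`.
  have hspec : ∀ f : MvPolynomial (PairIdx n) K, MvPolynomial.aeval x f = 0 →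
      MvPolynomial.aeval p f = 0 := by
    intro f hf
    have : f ∈ MvPolynomial.vanishingIdeal K Z := hx ▸ hf
    exact this p hpZ
  rw [varietyDim, ← hx, ringKrullDim_quotient_ker_aeval]
  refine WithBot.coe_le_coe.mpr ((transRank_mono (range_subset_matEntries x)).trans ?_)
  have hX := upperMatrix_blockTriangular fun q => x (Sum.inl q)
  have hY := upperMatrix_blockTriangular fun q => x (Sum.inr q)
  rcases heig with h | h
  · obtain ⟨i, j, hij⟩ := h.exists_diag_ne (upperMatrix_blockTriangular _)
    rw [matX_apply_self, matX_apply_self] at hij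
    refine hbound.transRank_le_of_exists_diag_ne hX hY hcomm ⟨i, j, ?_⟩
    have := ne_of_ker_aeval_le hspec hij
    rwa [← matX_apply_self x i, ← matX_apply_self x j] at this
  · obtain ⟨i, j, hij⟩ := h.exists_diag_ne (upperMatrix_blockTriangular _)
    rw [matY_apply_self, matY_apply_self] at hij
    rw [Set.union_comm]
    refine hbound.transRank_le_of_exists_diag_ne hY hX hcomm.symm ⟨i, j, ?_⟩
    have := ne_of_ker_aeval_le hspec hij
    rwa [← matY_apply_self x i, ← matY_apply_self x j] at this
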